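/- A JB$^*$-triple is a complex Banach space $E$ with a triple product $\{\cdot,\cdot,\cdot\}:E\times E\times E\to E$ that is linear and symmetric in the outer variables, conjugate linear in the middle one, and satisfies, with $L(a,b)(x)=\{a,b,x\}$: (1) $\{a,b,\{x,y,z\}\}=\{\{a,b,x\},y,z\}-\{x,\{b,a,y\},z\}+\{x,y,\{a,b,z\}\}$ for all $a,b,x,y,z\in E$; (2) each $L(a,a)$ is a bounded hermitian operator with non-negative spectrum, where a bounded operator $T$ on $E$ is hermitian if $\Phi(T)\in\mathbb{R}$ for every functional $\Phi$ on the Banach space $BL(E)$ of bounded operators on $E$ with $\|\Phi\|\le 1$ and $\Phi(I_E)=1$; (3) $\|\{x,x,x\}\|=\|x\|^3$ for all $x\in E$. Let $a$ be a norm-one element of a JB$^*$-triple $E$ and let $\varphi\in E^*$ be a norm-one functional with $\varphi(a)=1$. Then the sesquilinear form $(x\mid y)_\varphi=\varphi\{x,y,a\}$ $(x,y\in E)$ is hermitian, i.e. $(y\mid x)_\varphi=\overline{(x\mid y)_\varphi}$ for all $x,y\in E$, and semi-positive, i.e. $(x\mid x)_\varphi\ge 0$ for all $x\in E$, and it satisfies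 $(a\mid a)_\varphi=1$. -/

import Mathlib

open scoped ComplexOrder

/-- A (complex) Jordan triple system: a triple product `{x, y, z}`, linear and symmetric in the
outer variables and conjugate linear in the middle one, satisfying the Jordan identity. -/
class JordanTriple (E : Type*) [AddCommGroup E] [Module ℂ E] where
  /-- The triple product `(x, y, z) ↦ {x, y, z}`. -/
  triple : E →ₗ[ℂ] E →ₗ⋆[ℂ] E →ₗ[ℂ] E
  triple_symm : ∀ x y z : E, triple x y z = triple z y x
  jordan_identity : ∀ a b x y z : E,
    triple a b (triple x y z) =
      triple (triple a b x) y z - triple x (triple b a y) z + triple x y (triple a b z)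

/-- The operator `L(a, b) : x ↦ {a, b, x}`. -/
def JordanTriple.L {E : Type*} [AddCommGroup E] [Module ℂ E] [JordanTriple E] (a b : E) :
    E →ₗ[ℂ] E :=
  JordanTriple.triple a b

/-- The states of `X` relative to `u`: the functionals in the closed unit ball of the dual of `X`
taking the value `1` at `u`. -/
def relStates (X : Type*) [NormedAddCommGroup X] [NormedSpace ℂ X] (u : X) :
    Set (StrongDual ℂ X) :=
  {φ | ‖φ‖ ≤ 1 ∧ φ u = 1}

/-- The numerical range of `x` relative to `u`. -/
def numRange (X : Type*) [NormedAddCommGroup X] [NormedSpace ℂ X] (u x : X) : Set ℂ :=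
  {w | ∃ φ ∈ relStates X u, φ x = w}

/-- A bounded operator on a complex Banach space is hermitian if its numerical range, relative to
the identity in the Banach space of all bounded operators, consists of real numbers. -/
def IsHermitianOp {E : Type*} [NormedAddCommGroup E] [NormedSpace ℂ E] (T : E →L[ℂ] E) : Prop :=
  ∀ w ∈ numRange (E →L[ℂ] E) (ContinuousLinearMap.id ℂ E) T, w.im = 0

/-- A JB*-triple: a complex Banach space which is a Jordan triple system, such that each `L(a, a)`
is a (bounded) hermitian operator with non-negative spectrum, and `‖{x, x, x}‖ = ‖x‖ ^ 3`. -/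
class JBStarTriple (E : Type*) [NormedAddCommGroup E] [NormedSpace ℂ E] [CompleteSpace E]
    extends JordanTriple E where
  continuous_L : ∀ a : E, Continuous (JordanTriple.L a a)
  isHermitianOp_L : ∀ a : E, IsHermitianOp (⟨JordanTriple.L a a, continuous_L a⟩ : E →L[ℂ] E)
  spectrum_L_nonneg : ∀ a : E,
    ∀ w ∈ spectrum ℂ (⟨JordanTriple.L a a, continuous_L a⟩ : E →L[ℂ] E), 0 ≤ w
  norm_triple_self : ∀ x : E, ‖triple x x x‖ = ‖x‖ ^ 3

/-- The sesquilinear form `(x, y) ↦ φ {x, y, a}`. -/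
noncomputable def JBStarTriple.form {E : Type*} [NormedAddCommGroup E] [NormedSpace ℂ E]
    [CompleteSpace E] [JBStarTriple E] (φ : StrongDual ℂ E) (a : E) : E →ₗ[ℂ] E →ₗ⋆[ℂ] ℂ :=
  LinearMap.mk₂'ₛₗ (RingHom.id ℂ) (starRingEnd ℂ) (fun x y => φ (JordanTriple.triple x y a))
    (fun x x' y => by simp) (fun c x y => by simp) (fun x y y' => by simp) (fun c x y => by simp)

/-! ### Spectra and exponentials in a Banach algebra. -/

section BanachAlgebra

open Filter Topology NormedSpace

variable {A : Type*} [NormedRing A] [NormedAlgebra ℂ A] [CompleteSpace A]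

/-! Positivity rests on f(Te) ≥ 0 for T = L(x,x) whenever ‖f‖ ≤ 1 and f(e) = ‖e‖. A hermitian T
makes exp(itT) contractive; as the spectrum is non-negative, Phragmén-Lindelöf makes exp(-yT)
contractive for y ≥ 0, and differentiating Re f(exp(-yT)e) at y = 0 gives the claim
(`IsHermitianOp.apply_nonneg`). Polarization then yields hermitian symmetry.

For (a|a) = 1, the norm axiom bounds φ{a,a,a} above by 1. The lower bound follows from ‖3a -
{a,a,a}‖ ≤ 2, an instance of an odd functional calculus: ‖p(L(a,a))a‖ ≤ 1 if p is real and u p(u)² ≤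
1 on [0,1] (`JBStarTriple.norm_oddEval_le_one`). This needs L(a,a) to be contractive on the closed
subtriple generated by a. The triple product is bounded by some constant (closed graph, uniform
boundedness), and on odd polynomials in a, power associativity and ‖{x,x,x}‖ = ‖x‖³ improve the
constant to 1. -/

theorem exists_norm_pow_le_of_spectrum_norm_le {a : A} {r s : ℝ} (hr : 0 ≤ r) (hrs : r < s)
    (h : ∀ w ∈ spectrum ℂ a, ‖w‖ ≤ r) : ∃ C, 0 ≤ C ∧ ∀ n : ℕ, ‖a ^ n‖ ≤ C * s ^ n := by
  have hs : 0 < s := hr.trans_lt hrs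
  have h1 : spectralRadius ℂ a < ENNReal.ofReal s := by
    refine lt_of_le_of_lt (b := ENNReal.ofReal r) ?_ ((ENNReal.ofReal_lt_ofReal_iff hs).2 hrs)
    refine iSup₂_le fun w hw => ?_
    rw [← enorm_eq_nnnorm, ← ofReal_norm]
    exact ENNReal.ofReal_le_ofReal (h w hw)
  have h2 := (spectrum.pow_norm_pow_one_div_tendsto_nhds_spectralRadius a).eventually_lt_const h1
  have h3 : ∀ᶠ n : ℕ in atTop, ‖a ^ n‖ / s ^ n ≤ 1 := by
    filter_upwards [h2, eventually_gt_atTop 0] with n hn hn0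
    have h4 := (ENNReal.ofReal_lt_ofReal_iff hs).1 hn
    rw [div_le_one (by positivity)]
    calc ‖a ^ n‖ = (‖a ^ n‖ ^ (1 / n : ℝ)) ^ n := by
          rw [one_div, Real.rpow_inv_natCast_pow (norm_nonneg _) hn0.ne']
      _ ≤ s ^ n := by gcongr
  obtain ⟨C, hC⟩ := IsBoundedUnder.bddAbove_range (f := fun n : ℕ => ‖a ^ n‖ / s ^ n) ⟨1, h3⟩
  have hC' : ∀ n : ℕ, ‖a ^ n‖ / s ^ n ≤ C := fun n => hC ⟨n, rfl⟩
  refine ⟨C, le_trans (by positivity) (hC' 0), fun n => ?_⟩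
  rw [← div_le_iff₀ (by positivity)]
  exact hC' n

theorem exists_norm_aeval_pow_le {a : A} (ha : ∀ w ∈ spectrum ℂ a, 0 ≤ w ∧ ‖w‖ ≤ 1)
    {q : Polynomial ℂ} (hq : ∀ u : ℝ, 0 ≤ u → u ≤ 1 → ‖q.eval (u : ℂ)‖ ≤ 1) {s : ℝ} (hs : 1 < s) :
    ∃ C, 0 ≤ C ∧ ∀ n : ℕ, ‖Polynomial.aeval a q ^ n‖ ≤ C * s ^ n := by
  cases subsingleton_or_nontrivial A with
  | inl _ => exact ⟨0, le_rfl, fun n => by rw [Subsingleton.elim (Polynomial.aeval a q ^ n) 0]; simp⟩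
  | inr _ =>
    refine exists_norm_pow_le_of_spectrum_norm_le zero_le_one hs fun w hw => ?_
    rw [spectrum.map_polynomial_aeval_of_nonempty a q (spectrum.nonempty a)] at hw
    obtain ⟨v, hv, rfl⟩ := hw
    obtain ⟨h0, h1⟩ := ha v hv
    rw [Complex.nonneg_iff] at h0
    have hv' : v = (v.re : ℂ) := Complex.ext rfl (by simp [← h0.2])
    rw [hv'] at h1 ⊢
    rw [Complex.norm_real, Real.norm_of_nonneg h0.1] at h1
    exact hq _ h0.1 h1

theorem norm_exp_smul_le_of_norm_pow_le {a : A} {C s : ℝ}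
    (h : ∀ n : ℕ, ‖a ^ n‖ ≤ C * s ^ n) (z : ℂ) : ‖exp (z • a)‖ ≤ C * Real.exp (‖z‖ * s) := by
  have h1 : HasSum (fun n : ℕ => C * ((‖z‖ * s) ^ n / n.factorial)) (C * Real.exp (‖z‖ * s)) := by
    rw [Real.exp_eq_exp_ℝ]
    exact (expSeries_div_hasSum_exp (‖z‖ * s)).mul_left C
  have h2 := exp_series_hasSum_exp' (𝕂 := ℂ) (z • a)
  refine h2.norm_le_of_bounded h1 fun n => ?_
  rw [smul_pow, norm_smul, norm_smul, norm_inv, norm_pow, Complex.norm_natCast, mul_pow]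
  calc (n.factorial : ℝ)⁻¹ * (‖z‖ ^ n * ‖a ^ n‖)
      ≤ (n.factorial : ℝ)⁻¹ * (‖z‖ ^ n * (C * s ^ n)) := by gcongr; exact h n
    _ = _ := by ring

theorem exp_smul_one_sub (M : ℂ) (a : A) :
    exp (M • (1 : A) - a) = Complex.exp M • exp (-a) := by
  let _ : NormedAlgebra ℚ A := .restrictScalars ℚ ℂ A
  rw [sub_eq_add_neg, exp_add_of_commute ((Commute.one_left _).smul_left M),
    ← Algebra.algebraMap_eq_smul_one, ← algebraMap_exp_comm, Complex.exp_eq_exp_ℂ,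
    ← Algebra.smul_def]

/-- The spectrum of M - a lies in the disc of radius M, so (M - a)^n grows at most like (M + ε)^n;
then exp(-ya) = e^(-yM) exp(y(M - a)). -/
theorem exists_norm_exp_neg_smul_le {a : A} (h : ∀ w ∈ spectrum ℂ a, 0 ≤ w) {ε : ℝ} (hε : 0 < ε) :
    ∃ C, 0 ≤ C ∧ ∀ y : ℝ, 0 ≤ y → ‖exp (-((y : ℂ) • a))‖ ≤ C * Real.exp (y * ε) := by
  set M : ℝ := ‖a‖ * ‖(1 : A)‖ with hM
  have hM0 : 0 ≤ M := by positivity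
  have h1 : ∀ w ∈ spectrum ℂ ((M : ℂ) • (1 : A) - a), ‖w‖ ≤ M := by
    intro w hw
    rw [← Algebra.algebraMap_eq_smul_one, ← spectrum.singleton_sub_eq] at hw
    obtain ⟨_, rfl, v, hv, rfl⟩ := hw
    have hv0 := h v hv
    have hvM := spectrum.norm_le_norm_mul_of_mem hv
    rw [Complex.nonneg_iff] at hv0
    have hv' : v = (v.re : ℂ) := Complex.ext rfl (by simp [← hv0.2])
    rw [hv', Complex.norm_real, Real.norm_eq_abs, abs_of_nonneg hv0.1, ← hM] at hvM
    change ‖(M : ℂ) - v‖ ≤ M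
    rw [hv', ← Complex.ofReal_sub, Complex.norm_real, Real.norm_eq_abs, abs_of_nonneg (by linarith)]
    linarith
  obtain ⟨C, hC0, hC⟩ := exists_norm_pow_le_of_spectrum_norm_le (s := M + ε) hM0 (by linarith) h1
  refine ⟨C, hC0, fun y hy => ?_⟩
  have h2 := norm_exp_smul_le_of_norm_pow_le hC (y : ℂ)
  rw [smul_sub, smul_smul, exp_smul_one_sub, norm_smul, Complex.norm_exp, Complex.norm_real,
    Real.norm_eq_abs, abs_of_nonneg hy, mul_add, Real.exp_add, ← Complex.ofReal_mul,
    Complex.ofReal_re] at h2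
  have h3 := Real.exp_pos (y * M)
  nlinarith

/-- By the Phragmén-Lindelöf principle. -/
theorem norm_exp_neg_le_one {a : A} (h : ∀ w ∈ spectrum ℂ a, 0 ≤ w)
    (ha : ∀ t : ℝ, ‖exp ((t * Complex.I) • a)‖ ≤ 1) {y : ℝ} (hy : 0 ≤ y) :
    ‖exp (-((y : ℂ) • a))‖ ≤ 1 := by
  have key : ∀ ε : ℝ, 0 < ε → ‖exp (-((y : ℂ) • a))‖ ≤ Real.exp (y * ε) := by
    intro ε hε
    -- The factor exp(-εz) absorbs the growth e^(yε) on the positive axis and has modulus one on the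
    -- imaginary axis.
    set f : ℂ → A := fun z => Complex.exp (-(z * ε)) • exp (z • -a) with hf
    have hfd : Differentiable ℂ f := by fun_prop
    have h1 : ‖f y‖ ≤ 1 := by
      refine PhragmenLindelof.right_half_plane_of_bounded_on_real hfd.diffContOnCl ?_ ?_ ?_ ?_
      · obtain ⟨C, hC0, hC⟩ := exists_norm_pow_le_of_spectrum_norm_le (a := -a)
          (s := ‖-a‖ * ‖(1 : A)‖ + 1) (by positivity) (by linarith)
          fun w hw => spectrum.norm_le_norm_mul_of_mem hw
        set s := ‖-a‖ * ‖(1 : A)‖ + 1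
        -- Growth of order 1, below the critical order 2 of a half-plane.
        refine ⟨1, by norm_num, s, ?_⟩
        refine Asymptotics.IsBigO.of_bound C ?_
        filter_upwards [mem_inf_of_right (mem_principal_self _)] with z hz
        have hz' : 0 < z.re := hz
        have h3 := norm_exp_smul_le_of_norm_pow_le hC z
        have h4 : Real.exp (-(z * (ε : ℂ))).re ≤ 1 := by
          rw [Real.exp_le_one_iff]; simp; positivity
        rw [hf, norm_smul, Complex.norm_exp, Real.rpow_one, Real.norm_eq_abs, Real.abs_exp,
          mul_comm s]
        calc _ ≤ 1 * ‖exp (z • -a)‖ := by gcongr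
          _ ≤ _ := by rw [one_mul]; exact h3
      · obtain ⟨C, hC0, hC⟩ := exists_norm_exp_neg_smul_le h hε
        refine ⟨C, ?_⟩
        rw [eventually_map]
        filter_upwards [eventually_ge_atTop 0] with x hx
        have := hC x hx
        rw [hf, norm_smul, Complex.norm_exp, smul_neg]
        have h5 : (-((x : ℂ) * (ε : ℂ))).re = -(x * ε) := by simp
        rw [h5, Real.exp_neg]
        rw [inv_mul_le_iff₀ (Real.exp_pos _), mul_comm]
        exact this
      · intro x
        have h6 := ha (-x)
        rw [hf, norm_smul, Complex.norm_exp]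
        have h5 : (-((x * Complex.I : ℂ) * (ε : ℂ))).re = 0 := by simp
        rw [h5, Real.exp_zero, one_mul]
        have h7 : (x * Complex.I) • -a = (((-x : ℝ) : ℂ) * Complex.I) • a := by push_cast; module
        rw [h7]
        exact h6
      · simpa using hy
    rw [hf, norm_smul, Complex.norm_exp, smul_neg] at h1
    have h5 : (-((y : ℂ) * (ε : ℂ))).re = -(y * ε) := by simp
    rw [h5, Real.exp_neg, inv_mul_le_iff₀ (Real.exp_pos _), mul_one] at h1
    exact h1
  have h7 : Tendsto (fun ε : ℝ => Real.exp (y * ε)) (𝓝[>] 0) (𝓝 1) :=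
    (Continuous.tendsto' (by fun_prop) 0 1 (by simp)).mono_left nhdsWithin_le_nhds
  exact ge_of_tendsto h7 (by filter_upwards [self_mem_nhdsWithin] with ε hε using key ε hε)

end BanachAlgebra

/-! ### Dissipative and hermitian operators. -/

section Dissipative

open Filter Topology NormedSpace

variable {X : Type*} [NormedAddCommGroup X] [NormedSpace ℂ X]

/-- A bounded operator `A` is dissipative if `‖x‖ ≤ ‖x - s A x‖` for all `s ≥ 0`. -/
def IsDissipative (A : X →L[ℂ] X) : Prop :=
  ∀ s : ℝ, 0 ≤ s → ∀ x, ‖x‖ ≤ ‖x - (s : ℂ) • A x‖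

theorem isDissipative_of_re_nonpos {A : X →L[ℂ] X}
    (h : ∀ (f : StrongDual ℂ X) (x : X), ‖f‖ ≤ 1 → f x = ‖x‖ → (f (A x)).re ≤ 0) :
    IsDissipative A := by
  intro s hs x
  obtain ⟨f, hf, hfx⟩ := exists_dual_vector'' ℂ x
  have h1 := h f x hf hfx
  have h2 : (f x).re = ‖x‖ := by rw [hfx]; simp
  calc ‖x‖ ≤ (f (x - (s : ℂ) • A x)).re := by
        rw [map_sub, map_smul, smul_eq_mul, Complex.sub_re, Complex.re_ofReal_mul, h2]
        nlinarith
    _ ≤ ‖f (x - (s : ℂ) • A x)‖ := Complex.re_le_norm _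
    _ ≤ ‖x - (s : ℂ) • A x‖ := f.le_of_opNorm_le hf _ |>.trans_eq (one_mul _)

/-- Write exp(-A) as the n-th power of exp(-A/n), which differs from 1 - A/n by at most ε/n. Each
factor shrinks norms by at most 1 - ε/n, so by Bernoulli exp(-A) shrinks them by at most 1 - ε.
Hence its inverse exp(A) is a contraction. -/
theorem IsDissipative.norm_exp_le_one [CompleteSpace X] {A : X →L[ℂ] X} (h : IsDissipative A) :
    ‖exp A‖ ≤ 1 := by
  let _ : NormedAlgebra ℚ (X →L[ℂ] X) := .restrictScalars ℚ ℂ _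
  have key : ∀ ε : ℝ, 0 < ε → ∀ x, (1 - ε) * ‖x‖ ≤ ‖exp (-A) x‖ := by
    intro ε hε x
    have h1 : HasDerivAt (fun u : ℝ => exp (u • -A)) (-A) 0 := by
      simpa using hasDerivAt_exp_smul_const (𝕂 := ℝ) (-A) (0 : ℝ)
    have h2 := (hasDerivAt_iff_isLittleO_nhds_zero.1 h1).def hε
    have h3 := (tendsto_one_div_atTop_nhds_zero_nat (𝕜 := ℝ)).eventually h2
    obtain ⟨n, hn, hn0, hn1⟩ :=
      (h3.and ((eventually_gt_atTop 0).and (eventually_ge_atTop ⌈ε⌉₊))).exists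
    have hn1' : ε ≤ n := (Nat.le_ceil _).trans (mod_cast hn1)
    have hn0' : (0 : ℝ) < n := mod_cast hn0
    set B : X →L[ℂ] X := exp ((1 / n : ℝ) • -A) with hB
    simp only [zero_add, zero_smul, exp_zero] at hn
    have hstep : ∀ y, (1 - ε / n) * ‖y‖ ≤ ‖B y‖ := by
      intro y
      have h4 := h (1 / n) (by positivity) y
      have h5 := (B - 1 - (1 / n : ℝ) • -A).le_of_opNorm_le hn y
      have h6 : y - ((1 / n : ℝ) : ℂ) • A y = B y - (B - 1 - (1 / n : ℝ) • -A) y := by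
        rw [Complex.coe_smul]
        change _ = B y - (B y - y - (1 / n : ℝ) • -A y)
        module
      rw [h6] at h4
      have h7 := norm_sub_le (B y) ((B - 1 - (1 / n : ℝ) • -A) y)
      rw [Real.norm_of_nonneg (by positivity)] at h5
      have h8 : ε * (1 / n) * ‖y‖ = ε / n * ‖y‖ := by ring
      linarith
    have hq : 0 ≤ 1 - ε / n := by
      rw [sub_nonneg, div_le_one hn0']; exact hn1'
    have hpow : ∀ k : ℕ, (1 - ε / n) ^ k * ‖x‖ ≤ ‖(B ^ k) x‖ := by
      intro k
      induction k with
      | zero => simp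
      | succ k ih =>
        rw [pow_succ', pow_succ', mul_apply_eq_comp, mul_assoc]
        exact (mul_le_mul_of_nonneg_left ih hq).trans (hstep _)
    have hBn : B ^ n = exp (-A) := by
      rw [hB, ← exp_nsmul, ← Nat.cast_smul_eq_nsmul ℝ, smul_smul,
        mul_one_div_cancel hn0'.ne', one_smul]
    rw [← hBn]
    refine le_trans ?_ (hpow n)
    gcongr
    have := one_add_mul_le_pow (a := -(ε / n)) (by linarith) n
    have h9 : (n : ℝ) * -(ε / n) = -ε := by field_simp
    rw [h9] at this
    simpa [sub_eq_add_neg] using this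
  have key2 : ∀ x, ‖x‖ ≤ ‖exp (-A) x‖ := by
    intro x
    have h7 : Tendsto (fun ε : ℝ => (1 - ε) * ‖x‖) (𝓝[>] 0) (𝓝 ‖x‖) :=
      (Continuous.tendsto' (by fun_prop) 0 _ (by simp)).mono_left nhdsWithin_le_nhds
    exact le_of_tendsto h7 (by filter_upwards [self_mem_nhdsWithin] with ε hε using key ε hε x)
  refine ContinuousLinearMap.opNorm_le_bound _ zero_le_one fun x => ?_
  have h10 : exp (-A) (exp A x) = x := by
    rw [← mul_apply_eq_comp, ← exp_add_of_commute (Commute.refl A).neg_left,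
      neg_add_cancel, exp_zero, one_apply_eq_self]
  have := key2 (exp A x)
  rwa [h10, ← one_mul ‖x‖] at this

/-- On t ≥ 0 the function Re f(exp(tA)x) is maximal at t = 0, so its right derivative there is
non-positive. -/
theorem re_apply_nonpos_of_norm_exp_le_one [CompleteSpace X] {A : X →L[ℂ] X}
    (h : ∀ t : ℝ, 0 ≤ t → ‖exp ((t : ℂ) • A)‖ ≤ 1) {f : StrongDual ℂ X} {x : X} (hf : ‖f‖ ≤ 1)
    (hfx : f x = ‖x‖) : (f (A x)).re ≤ 0 := by
  have h1 : HasDerivAt (fun u : ℝ => exp (u • A)) A 0 := by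
    simpa using hasDerivAt_exp_smul_const (𝕂 := ℝ) A (0 : ℝ)
  let Ψ : (X →L[ℂ] X) →L[ℝ] ℝ :=
    Complex.reCLM.comp ((f.comp (ContinuousLinearMap.apply ℂ X x)).restrictScalars ℝ)
  have h2 : HasDerivAt (fun u : ℝ => Ψ (exp (u • A))) (Ψ A) 0 :=
    Ψ.hasFDerivAt.comp_hasDerivAt 0 h1
  have h3 := h2.tendsto_slope_zero_right
  refine le_of_tendsto h3 ?_
  filter_upwards [self_mem_nhdsWithin] with t ht
  have ht' : (0 : ℝ) < t := ht
  refine mul_nonpos_of_nonneg_of_nonpos (by positivity) ?_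
  have h4 : Ψ (exp ((0 + t) • A)) ≤ ‖x‖ := by
    rw [zero_add]
    calc (f (exp (t • A) x)).re ≤ ‖f (exp (t • A) x)‖ := Complex.re_le_norm _
      _ ≤ ‖exp (t • A) x‖ := f.le_of_opNorm_le hf _ |>.trans_eq (one_mul _)
      _ ≤ ‖x‖ := ((exp (t • A)).le_of_opNorm_le (h t ht'.le) x).trans_eq (one_mul _)
  have h5 : Ψ (exp ((0 : ℝ) • A)) = ‖x‖ := by
    rw [zero_smul, exp_zero]
    change (f x).re = _
    simp [hfx]
  linarith

/-- A bounded operator with vanishing numerical range is zero (by Liouville's theorem). -/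
theorem eq_zero_of_apply_eq_zero [CompleteSpace X] {S : X →L[ℂ] X}
    (h : ∀ (f : StrongDual ℂ X) (x : X), ‖f‖ ≤ 1 → f x = ‖x‖ → f (S x) = 0) : S = 0 := by
  have h1 : ∀ z : ℂ, ‖exp (z • S)‖ ≤ 1 := fun z =>
    (isDissipative_of_re_nonpos fun f x hf hfx => by simp [h f x hf hfx]).norm_exp_le_one
  have h2 : Differentiable ℂ fun z : ℂ => exp (z • S) := by fun_prop
  have h3 : ∀ z : ℂ, exp (z • S) = 1 := fun z => by
    have := h2.apply_eq_apply_of_bounded (isBounded_iff_forall_norm_le.2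
      ⟨1, by rintro _ ⟨w, rfl⟩; exact h1 w⟩) z 0
    simpa using this
  have h4 : HasDerivAt (fun z : ℂ => exp (z • S)) S 0 := by
    simpa using hasDerivAt_exp_smul_const (𝕂 := ℂ) S (0 : ℂ)
  simp only [h3] at h4
  exact h4.unique (hasDerivAt_const _ _)

/-- For x ≠ 0, S ↦ f(Sx)/‖x‖ is a state on the bounded operators. -/
theorem IsHermitianOp.im_apply_eq_zero {T : X →L[ℂ] X} (hT : IsHermitianOp T)
    {f : StrongDual ℂ X} {x : X} (hf : ‖f‖ ≤ 1) (hfx : f x = ‖x‖) : (f (T x)).im = 0 := by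
  by_cases hx : x = 0
  · simp [hx]
  have hx' : ‖x‖ ≠ 0 := norm_ne_zero_iff.2 hx
  let Φ : StrongDual ℂ (X →L[ℂ] X) := ((‖x‖⁻¹ : ℝ) : ℂ) • f.comp (ContinuousLinearMap.apply ℂ X x)
  have h1 : ∀ S : X →L[ℂ] X, Φ S = ((‖x‖⁻¹ : ℝ) : ℂ) * f (S x) := fun S => rfl
  have h2 : (Φ T).im = 0 := by
    refine hT _ ⟨Φ, ⟨?_, ?_⟩, rfl⟩
    · refine ContinuousLinearMap.opNorm_le_bound _ zero_le_one fun S => ?_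
      rw [h1, norm_mul, Complex.norm_real, norm_inv, norm_norm, one_mul, inv_mul_le_iff₀
        (by positivity), mul_comm]
      exact (f.le_of_opNorm_le hf _).trans ((one_mul _).trans_le (S.le_opNorm x))
    · rw [h1, ContinuousLinearMap.id_apply, hfx]
      simp [hx']
  rw [h1, Complex.im_ofReal_mul] at h2
  exact (mul_eq_zero.1 h2).resolve_left (by positivity)

theorem IsHermitianOp.isDissipative_smul_I {T : X →L[ℂ] X} (hT : IsHermitianOp T) (t : ℝ) :
    IsDissipative ((t * Complex.I) • T) :=
  isDissipative_of_re_nonpos fun f x hf hfx => by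
    simp [hT.im_apply_eq_zero hf hfx]

theorem IsHermitianOp.apply_nonneg [CompleteSpace X] {T : X →L[ℂ] X} (hT : IsHermitianOp T)
    (hs : ∀ w ∈ spectrum ℂ T, 0 ≤ w) {f : StrongDual ℂ X} {x : X} (hf : ‖f‖ ≤ 1)
    (hfx : f x = ‖x‖) : 0 ≤ f (T x) := by
  rw [Complex.nonneg_iff]
  refine ⟨?_, (hT.im_apply_eq_zero hf hfx).symm⟩
  have := re_apply_nonpos_of_norm_exp_le_one (A := -T) (fun t ht => by
    rw [smul_neg]
    exact norm_exp_neg_le_one hs (fun t => (hT.isDissipative_smul_I t).norm_exp_le_one) ht) hf hfx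
  simpa using this

theorem IsHermitianOp.isDissipative_neg [CompleteSpace X] {T : X →L[ℂ] X} (hT : IsHermitianOp T)
    (hs : ∀ w ∈ spectrum ℂ T, 0 ≤ w) : IsDissipative (-T) :=
  isDissipative_of_re_nonpos fun f x hf hfx => by
    have := (Complex.nonneg_iff.1 (hT.apply_nonneg hs hf hfx)).1
    simpa using this

/-- For c = -1, i, -i the number e^(cw) lies in the spectrum of the contraction exp(cT), so Re(cw) ≤
0. -/
theorem nonneg_of_mem_spectrum_of_isDissipative [CompleteSpace X] {T : X →L[ℂ] X}
    (h1 : IsDissipative (-T)) (h2 : IsDissipative (Complex.I • T))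
    (h3 : IsDissipative (-Complex.I • T)) {w : ℂ} (hw : w ∈ spectrum ℂ T) : 0 ≤ w := by
  have h1' : IsDissipative ((-1 : ℂ) • T) := by simpa using h1
  have key : ∀ c : ℂ, c ≠ 0 → IsDissipative (c • T) → (c * w).re ≤ 0 := by
    intro c hc h
    have h4 : c * w ∈ spectrum ℂ (c • T) := by
      have := spectrum.smul_mem_smul_iff (r := Units.mk0 c hc) (s := w) (a := T)
      exact this.2 hw
    have h5 := spectrum.norm_le_norm_mul_of_mem (spectrum.exp_mem_exp _ h4)
    rw [← Complex.exp_eq_exp_ℂ, Complex.norm_exp] at h5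
    have h6 : ‖exp (c • T)‖ * ‖(1 : X →L[ℂ] X)‖ ≤ 1 * 1 := by
      gcongr
      · exact h.norm_exp_le_one
      · exact ContinuousLinearMap.norm_id_le
    rw [← Real.exp_le_one_iff]
    linarith
  have e1 := key _ (by simp) h1'
  have e2 := key _ (by simp) h2
  have e3 := key _ (by simp) h3
  simp at e1 e2 e3
  rw [Complex.nonneg_iff]
  exact ⟨e1, by linarith⟩

theorem norm_le_one_of_mem_spectrum [CompleteSpace X] {T : X →L[ℂ] X} (hT : ‖T‖ ≤ 1) {w : ℂ}
    (hw : w ∈ spectrum ℂ T) : ‖w‖ ≤ 1 :=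
  calc ‖w‖ ≤ ‖T‖ * ‖(1 : X →L[ℂ] X)‖ := spectrum.norm_le_norm_mul_of_mem hw
    _ ≤ 1 * 1 := mul_le_mul hT ContinuousLinearMap.norm_id_le (norm_nonneg _) zero_le_one
    _ = 1 := one_mul 1

theorem exists_norm_aeval_pow_apply_le [CompleteSpace X] {T : X →L[ℂ] X} (hT : ‖T‖ ≤ 1)
    (hs : ∀ w ∈ spectrum ℂ T, 0 ≤ w) {q : Polynomial ℂ}
    (hq : ∀ u : ℝ, 0 ≤ u → u ≤ 1 → ‖q.eval (u : ℂ)‖ ≤ 1) {s : ℝ} (h : 1 < s) :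
    ∃ C, 0 ≤ C ∧ ∀ (n : ℕ) (x : X), ‖Polynomial.aeval T (q ^ n) x‖ ≤ C * s ^ n * ‖x‖ := by
  obtain ⟨C, hC0, hC⟩ := exists_norm_aeval_pow_le (a := T)
    (fun w hw => ⟨hs w hw, norm_le_one_of_mem_spectrum hT hw⟩) hq h
  refine ⟨C, hC0, fun n x => ?_⟩
  rw [map_pow]
  exact (Polynomial.aeval T q ^ n).le_of_opNorm_le (hC n) x

end Dissipative

/-- A sesquilinear form which is real on the diagonal is hermitian. -/
theorem LinearMap.conj_apply_eq_of_forall_im_apply_self {V : Type*} [AddCommGroup V] [Module ℂ V]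
    (B : V →ₗ[ℂ] V →ₗ⋆[ℂ] ℂ) (h : ∀ x, (B x x).im = 0) (x y : V) :
    B y x = starRingEnd ℂ (B x y) := by
  have h1 := h (x + y)
  have h2 := h (x + Complex.I • y)
  simp only [map_add, LinearMap.add_apply, Complex.add_im, h, map_smul, map_smulₛₗ,
    LinearMap.smul_apply, smul_eq_mul, Complex.conj_I, Complex.mul_im, Complex.neg_im,
    Complex.neg_re, Complex.I_re, Complex.I_im, Complex.add_re, Complex.mul_re] at h1 h2
  apply Complex.ext
  · simp only [Complex.conj_re]
    linarith
  · simp only [Complex.conj_im]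
    linarith

/-! ### Positivity of the form and boundedness of the triple product. -/

namespace JBStarTriple

open JordanTriple Filter Topology

variable {E : Type*} [NormedAddCommGroup E] [NormedSpace ℂ E] [CompleteSpace E] [JBStarTriple E]

theorem form_self_nonneg {f : StrongDual ℂ E} {e : E} (hf : ‖f‖ ≤ 1) (hfe : f e = ‖e‖) (x : E) :
    0 ≤ form f e x x :=
  (isHermitianOp_L x).apply_nonneg (spectrum_L_nonneg x) hf hfe

theorem form_conj_symm {f : StrongDual ℂ E} {e : E} (hf : ‖f‖ ≤ 1) (hfe : f e = ‖e‖) (x y : E) :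
    form f e y x = starRingEnd ℂ (form f e x y) :=
  LinearMap.conj_apply_eq_of_forall_im_apply_self _
    (fun x => (Complex.nonneg_iff.1 (form_self_nonneg hf hfe x)).2.symm) x y

theorem triple_polarization (x y z : E) : (4 : ℂ) • triple x y z =
    triple (x + y) (x + y) z - triple (x - y) (x - y) z +
    Complex.I • triple (x + Complex.I • y) (x + Complex.I • y) z -
    Complex.I • triple (x - Complex.I • y) (x - Complex.I • y) z := by
  have hI : Complex.I * Complex.I = -1 := Complex.I_mul_I
  simp only [map_add, map_sub, LinearMap.add_apply, LinearMap.sub_apply, map_smul, map_smulₛₗ,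
    LinearMap.smul_apply, LinearMap.neg_apply, Complex.conj_I, smul_add, smul_sub, smul_smul, hI, smul_neg, neg_smul,
    neg_neg, one_smul]
  module

theorem continuous_triple (x y : E) : Continuous (triple x y) := by
  have h : ∀ a : E, Continuous (triple a a) := continuous_L
  have h1 : ⇑(triple x y) = fun z => (4 : ℂ)⁻¹ • (triple (x + y) (x + y) z -
      triple (x - y) (x - y) z +
      Complex.I • triple (x + Complex.I • y) (x + Complex.I • y) z -
      Complex.I • triple (x - Complex.I • y) (x - Complex.I • y) z) := by
    funext z
    rw [← triple_polarization, smul_smul, inv_mul_cancel₀ (by norm_num), one_smul]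
  rw [h1]
  have h2 := h (x + y)
  have h3 := h (x - y)
  have h4 := h (x + Complex.I • y)
  have h5 := h (x - Complex.I • y)
  fun_prop

/-- The operator `L(x, y)` as a bounded operator. -/
def boundedL (x y : E) : E →L[ℂ] E := ⟨L x y, continuous_triple x y⟩

@[simp]
theorem boundedL_apply (x y z : E) : boundedL x y z = triple x y z := rfl

/-- The real linear map `y ↦ L(x, y)`. -/
def boundedLRight (x : E) : E →ₗ[ℝ] E →L[ℂ] E where
  toFun y := boundedL x y
  map_add' y z := by ext; simp
  map_smul' c y := by
    ext z
    have := (triple x).map_smulₛₗ (c : ℂ) y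
    simp only [Complex.coe_smul, Complex.conj_ofReal] at this
    simp [this]

/-- Closed graph: hermitian symmetry turns f{x,z,e} into the conjugate of f{e,x,z}, which is
continuous in z. So the limit operator and L(x,y) agree on all norming pairs, hence are equal. -/
theorem continuous_boundedLRight (x : E) : Continuous (boundedLRight x) := by
  refine LinearMap.continuous_of_seq_closed_graph (boundedLRight x) fun u y S hu hS => ?_
  rw [← sub_eq_zero]
  refine eq_zero_of_apply_eq_zero fun f e hf hfe => ?_
  have h1 : Tendsto (fun n => f (boundedLRight x (u n) e)) atTop (𝓝 (f (S e))) :=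
    ((f.continuous.comp (ContinuousLinearMap.apply ℂ E e).continuous).tendsto S).comp hS
  have h2 : ∀ z, f (boundedLRight x z e) = starRingEnd ℂ (f (triple e x z)) := fun z => by
    rw [triple_symm]
    exact form_conj_symm hf hfe z x
  have h3 : Tendsto (fun n => f (boundedLRight x (u n) e)) atTop
      (𝓝 (f (boundedLRight x y e))) := by
    simp only [h2]
    exact ((Complex.continuous_conj.comp (f.continuous.comp
      (continuous_triple e x))).tendsto y).comp hu
  rw [sub_apply, map_sub, sub_eq_zero]
  exact tendsto_nhds_unique h1 h3

theorem exists_norm_triple_le :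
    ∃ C : ℝ, 0 < C ∧ ∀ x y z : E, ‖triple x y z‖ ≤ C * (‖x‖ * ‖y‖ * ‖z‖) := by
  have h1 : ∀ z : E, ∃ D : ℝ, 0 ≤ D ∧ ∀ x y : E, ‖triple x y z‖ ≤ D * ‖y‖ * ‖x‖ := fun z => by
    let G : E →L[ℝ] E →L[ℂ] E := ⟨boundedLRight z, continuous_boundedLRight z⟩
    refine ⟨‖G‖, G.opNorm_nonneg, fun x y => ?_⟩
    rw [triple_symm]
    exact (G y).le_of_opNorm_le (G.le_opNorm y) x
  obtain ⟨C, hC⟩ := banach_steinhaus (ι := E × E)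
    -- Normalized pairs; zero entries are harmless since `0⁻¹ = 0`.
    (g := fun p => ((‖p.1‖⁻¹ * ‖p.2‖⁻¹ : ℝ) : ℂ) • boundedL p.1 p.2) (fun z => by
      obtain ⟨D, hD0, hD⟩ := h1 z
      refine ⟨D, fun p => ?_⟩
      rw [smul_apply, norm_smul, Complex.norm_real, boundedL_apply,
        Real.norm_of_nonneg (by positivity)]
      calc _ ≤ ‖p.1‖⁻¹ * ‖p.2‖⁻¹ * (D * ‖p.2‖ * ‖p.1‖) := by gcongr; exact hD _ _
        _ = D * ((‖p.2‖⁻¹ * ‖p.2‖) * (‖p.1‖⁻¹ * ‖p.1‖)) := by ring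
        _ ≤ D * (1 * 1) := by gcongr <;> exact inv_mul_le_one
        _ = D := by ring)
  refine ⟨max C 1, by positivity, fun x y z => ?_⟩
  by_cases hx : x = 0
  · simp [hx]
  by_cases hy : y = 0
  · simp [hy]
  have hx' := norm_pos_iff.2 hx
  have hy' := norm_pos_iff.2 hy
  have h3 := hC (x, y)
  simp only [norm_smul, Complex.norm_real] at h3
  rw [Real.norm_of_nonneg (by positivity), ← mul_inv, inv_mul_le_iff₀ (by positivity)] at h3
  calc ‖triple x y z‖ ≤ ‖x‖ * ‖y‖ * C * ‖z‖ := (boundedL x y).le_of_opNorm_le h3 z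
    _ ≤ ‖x‖ * ‖y‖ * max C 1 * ‖z‖ := by gcongr; exact le_max_left _ _
    _ = _ := by ring

end JBStarTriple

/-! ### Power associativity and odd functional calculus. -/

namespace JordanTriple

open Polynomial

variable {E : Type*} [AddCommGroup E] [Module ℂ E] [JordanTriple E]

/-- The odd powers `a ^ (2 k + 1) = L(a, a) ^ k a` of an element of a Jordan triple. -/
def oddPow (a : E) (k : ℕ) : E := (L a a ^ k) a

@[simp]
theorem oddPow_zero (a : E) : oddPow a 0 = a := by simp [oddPow]

theorem oddPow_succ (a : E) (k : ℕ) : oddPow a (k + 1) = triple a a (oddPow a k) := by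
  rw [oddPow, pow_succ']; rfl

theorem triple_oddPow_of_add_le (a : E) (N : ℕ) : ∀ i j k, i + j + k ≤ N →
    triple (oddPow a i) (oddPow a j) (oddPow a k) = oddPow a (i + j + k + 1) := by
  induction N with
  | zero =>
    intro i j k h
    obtain ⟨rfl, rfl, rfl⟩ : i = 0 ∧ j = 0 ∧ k = 0 := by omega
    simp [oddPow_succ]
  | succ N ih =>
    have hz : ∀ m, triple a a (oddPow a m) = oddPow a (m + 1) := fun m => (oddPow_succ a m).symm
    -- L(`oddPow a i`, `oddPow a j`) acts on {a, a, `oddPow a m`}, leaving only products with a in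
    -- the first or middle slot.
    have h1 : ∀ i j m, i + j + m = N → triple (oddPow a i) (oddPow a j) (oddPow a (m + 1)) =
        triple (oddPow a (i + j + 1)) a (oddPow a m) -
        triple a (oddPow a (i + j + 1)) (oddPow a m) + oddPow a (N + 2) := by
      intro i j m h
      have h2 := jordan_identity (oddPow a i) (oddPow a j) a a (oddPow a m)
      have e1 : triple (oddPow a i) (oddPow a j) a = oddPow a (i + j + 1) := by
        simpa using ih i j 0 (by omega)
      have e2 : triple (oddPow a j) (oddPow a i) a = oddPow a (i + j + 1) := by
        have := ih j i 0 (by omega)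
        rw [oddPow_zero] at this
        rw [this]
        congr 1
        omega
      rw [hz, e1, e2, ih i j m (by omega), hz] at h2
      rw [h2, h]
    have hq0 : triple a (oddPow a (N + 1)) a = oddPow a (N + 2) := by
      have h2 := h1 0 N 0 (by omega)
      have h3 := jordan_identity a a a (oddPow a N) a
      have e1 : triple a (oddPow a N) a = oddPow a (N + 1) := by
        simpa using ih 0 N 0 (by omega)
      have e2 : triple a a a = oddPow a 1 := by simp [oddPow_succ]
      rw [e1, hz, e2, ← oddPow_succ, triple_symm (oddPow a 1)] at h3
      simp only [oddPow_zero, zero_add] at h2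
      rw [triple_symm (oddPow a (N + 1)), hz] at h2
      rw [h2] at h3
      -- With Q the unknown product and P its expected value, the identities combine to P = 2(2P -
      -- Q) - Q.
      have h4 : (3 : ℂ) • (triple a (oddPow a (N + 1)) a - oddPow a (N + 2)) = 0 := by
        have h5 : (3 : ℂ) • (triple a (oddPow a (N + 1)) a - oddPow a (N + 2)) =
          oddPow a (N + 2) - (oddPow a (N + 2) - triple a (oddPow a (N + 1)) a +
          oddPow a (N + 2) - triple a (oddPow a (N + 1)) a +
          (oddPow a (N + 2) - triple a (oddPow a (N + 1)) a + oddPow a (N + 2))) := by module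
        rw [h5, ← h3, sub_self]
      exact sub_eq_zero.1 ((smul_eq_zero.1 h4).resolve_left (by norm_num))
    have hQ : ∀ m q, q + m = N + 1 → triple (oddPow a q) a (oddPow a m) = oddPow a (N + 2) ∧
        triple a (oddPow a q) (oddPow a m) = oddPow a (N + 2) := by
      intro m
      induction m with
      | zero =>
        rintro q rfl
        rw [oddPow_zero, triple_symm, hz]
        exact ⟨rfl, hq0⟩
      | succ m ihm =>
        intro q hq
        obtain ⟨e1, e2⟩ := ihm (q + 1) (by omega)
        have h2 := h1 q 0 m (by omega)
        have h3 := h1 0 q m (by omega)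
        simp only [add_zero, zero_add, oddPow_zero, e1, e2, sub_self] at h2 h3
        exact ⟨h2, h3⟩
    have hsucc : ∀ i j k, i + j + k = N → triple (oddPow a i) (oddPow a j) (oddPow a (k + 1)) =
        oddPow a (N + 2) := by
      intro i j k h
      obtain ⟨e1, e2⟩ := hQ k (i + j + 1) (by omega)
      rw [h1 i j k h, e1, e2, sub_self, zero_add]
    intro i j k h
    rcases Nat.lt_or_ge (i + j + k) (N + 1) with h' | h'
    · exact ih i j k (by omega)
    have h'' : i + j + k + 1 = N + 2 := by omega
    rw [h'']
    cases k with
    | succ k => exact hsucc i j k (by omega)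
    | zero =>
      cases i with
      | succ i =>
        rw [triple_symm]
        exact hsucc 0 j i (by omega)
      | zero =>
        obtain rfl : j = N + 1 := by omega
        simpa using hq0

/-- Power associativity of Jordan triples. -/
theorem triple_oddPow (a : E) (i j k : ℕ) :
    triple (oddPow a i) (oddPow a j) (oddPow a k) = oddPow a (i + j + k + 1) :=
  triple_oddPow_of_add_le a _ i j k le_rfl

/-- The odd functional calculus `p ↦ p(L(a, a)) a`. -/
noncomputable def oddEval (a : E) : ℂ[X] →ₗ[ℂ] E :=
  (LinearMap.applyₗ a).comp (aeval (L a a)).toLinearMap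

theorem oddEval_apply (a : E) (p : ℂ[X]) : oddEval a p = aeval (L a a) p a := rfl

theorem oddEval_monomial (a : E) (n : ℕ) (c : ℂ) :
    oddEval a (monomial n c) = c • oddPow a n := by
  simp [oddEval_apply, aeval_monomial, oddPow]

/-- `oddEval a p` stands for the odd function t p(t²); a product of three carries t³ = t · t²,
whence the factor `X`. -/
theorem triple_oddEval (a : E) (p q r : ℂ[X]) :
    triple (oddEval a p) (oddEval a q) (oddEval a r) =
      oddEval a (X * p * q.map (starRingEnd ℂ) * r) := by
  induction p using Polynomial.induction_on' with
  | add p p' hp hp' => simp only [map_add, LinearMap.add_apply, mul_add, add_mul, hp, hp']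
  | monomial i b =>
    induction q using Polynomial.induction_on' with
    | add q q' hq hq' =>
      simp only [map_add, Polynomial.map_add, LinearMap.add_apply, mul_add, add_mul, hq, hq']
    | monomial j c =>
      induction r using Polynomial.induction_on' with
      | add r r' hr hr' => simp only [map_add, mul_add, hr, hr']
      | monomial k d =>
        rw [map_monomial, X_mul_monomial, monomial_mul_monomial, monomial_mul_monomial]
        simp only [oddEval_monomial, map_smul, map_smulₛₗ, LinearMap.smul_apply, triple_oddPow,
          smul_smul]
        congr 1
        · ring
        · congr 1
          ring

end JordanTriple

/-! ### Contractivity of the triple product on odd polynomials in a. -/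

namespace JBStarTriple

open JordanTriple Polynomial

variable {E : Type*} [NormedAddCommGroup E] [NormedSpace ℂ E] [CompleteSpace E] [JBStarTriple E]

theorem norm_oddEval_pow_three (a : E) (p : ℂ[X]) :
    ‖oddEval a (X * p * p.map (starRingEnd ℂ) * p)‖ = ‖oddEval a p‖ ^ 3 := by
  rw [← triple_oddEval, norm_triple_self]

/-- Cubing the three arguments cubes their product, so the same C serves at every power 3^j; taking
roots removes it. -/
theorem norm_triple_oddEval_pow_le (a : E) {C : ℝ} (hC : ∀ x y z : E,
    ‖triple x y z‖ ≤ C * (‖x‖ * ‖y‖ * ‖z‖)) (j : ℕ) : ∀ p q r : ℂ[X],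
    ‖triple (oddEval a p) (oddEval a q) (oddEval a r)‖ ^ 3 ^ j ≤
      C * (‖oddEval a p‖ * ‖oddEval a q‖ * ‖oddEval a r‖) ^ 3 ^ j := by
  induction j with
  | zero => intro p q r; simpa using hC _ _ _
  | succ j ih =>
    intro p q r
    have h1 := ih (X * p * p.map (starRingEnd ℂ) * p) (X * q * q.map (starRingEnd ℂ) * q)
      (X * r * r.map (starRingEnd ℂ) * r)
    simp only [norm_oddEval_pow_three] at h1
    have hconj : ∀ s : ℂ[X], (s.map (starRingEnd ℂ)).map (starRingEnd ℂ) = s := fun s => by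
      rw [Polynomial.map_map]; simp
    have hpoly : X * (X * p * p.map (starRingEnd ℂ) * p) *
          (X * q * q.map (starRingEnd ℂ) * q).map (starRingEnd ℂ) *
          (X * r * r.map (starRingEnd ℂ) * r) =
        X * (X * p * q.map (starRingEnd ℂ) * r) *
          (X * p * q.map (starRingEnd ℂ) * r).map (starRingEnd ℂ) *
          (X * p * q.map (starRingEnd ℂ) * r) := by
      simp only [Polynomial.map_mul, Polynomial.map_X, hconj]
      generalize p.map (starRingEnd ℂ) = p'
      generalize q.map (starRingEnd ℂ) = q'
      generalize r.map (starRingEnd ℂ) = r'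
      ring
    rw [triple_oddEval, hpoly, norm_oddEval_pow_three, ← pow_mul, ← pow_succ', ← mul_pow,
      ← mul_pow, ← pow_mul, ← pow_succ'] at h1
    rw [triple_oddEval]
    exact h1

theorem le_of_forall_pow_three_pow_le {x y C : ℝ} (hy : 0 ≤ y)
    (h : ∀ j : ℕ, x ^ 3 ^ j ≤ C * y ^ 3 ^ j) : x ≤ y := by
  by_contra! hlt
  rcases hy.eq_or_lt with rfl | hy
  · have := h 0
    simp at this
    linarith
  have h1 : 1 < x / y := (one_lt_div hy).2 hlt
  obtain ⟨n, hn⟩ := pow_unbounded_of_one_lt C h1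
  have h2 := h n
  rw [← div_le_iff₀ (by positivity), ← div_pow] at h2
  have h3 : (x / y) ^ n ≤ (x / y) ^ 3 ^ n := pow_le_pow_right₀ h1.le (Nat.lt_pow_self (by norm_num)).le
  linarith

theorem norm_triple_oddEval_le (a : E) (p q r : ℂ[X]) :
    ‖triple (oddEval a p) (oddEval a q) (oddEval a r)‖ ≤
      ‖oddEval a p‖ * ‖oddEval a q‖ * ‖oddEval a r‖ := by
  obtain ⟨C, -, hC⟩ := exists_norm_triple_le (E := E)
  exact le_of_forall_pow_three_pow_le (by positivity)
    fun j => norm_triple_oddEval_pow_le a hC j p q r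

end JBStarTriple

/-! ### The closed subtriple generated by a, and the value at a. -/

namespace JBStarTriple

open JordanTriple Polynomial

variable {E : Type*} [NormedAddCommGroup E] [NormedSpace ℂ E] [CompleteSpace E] [JBStarTriple E]

/-- The closed subtriple generated by `a`. -/
noncomputable def closedSpan (a : E) : Submodule ℂ E :=
  (LinearMap.range (oddEval a)).topologicalClosure

instance (a : E) : CompleteSpace (closedSpan a) :=
  (Submodule.isClosed_topologicalClosure _).completeSpace_coe

theorem oddEval_mem_closedSpan (a : E) (p : ℂ[X]) : oddEval a p ∈ closedSpan a :=
  Submodule.le_topologicalClosure _ ⟨p, rfl⟩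

theorem closedSpan_induction {a : E} {P : E → Prop} (hP : IsClosed {x | P x})
    (h : ∀ p, P (oddEval a p)) {x : E} (hx : x ∈ closedSpan a) : P x :=
  closure_minimal (t := {x | P x}) (by rintro _ ⟨p, rfl⟩; exact h p) hP hx

theorem triple_self_oddEval (a : E) (p : ℂ[X]) :
    triple a a (oddEval a p) = oddEval a (X * p) := by
  simp only [oddEval_apply, map_mul, aeval_X]
  rfl

theorem boundedL_mem_closedSpan (a : E) {x : E} (hx : x ∈ closedSpan a) :
    boundedL a a x ∈ closedSpan a := by
  refine closedSpan_induction (P := fun x => boundedL a a x ∈ closedSpan a) ?_ (fun p => ?_) hx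
  · exact (Submodule.isClosed_topologicalClosure _).preimage (boundedL a a).continuous
  · rw [boundedL_apply, triple_self_oddEval]
    exact oddEval_mem_closedSpan a _

/-- The restriction of `L(a, a)` to the closed subtriple generated by `a`. -/
noncomputable def restrictedL (a : E) : closedSpan a →L[ℂ] closedSpan a :=
  ((boundedL a a).comp (closedSpan a).subtypeL).codRestrict (closedSpan a)
    fun x => boundedL_mem_closedSpan a x.2

theorem norm_restrictedL_le_one {a : E} (ha : ‖a‖ = 1) : ‖restrictedL a‖ ≤ 1 := by
  refine ContinuousLinearMap.opNorm_le_bound _ zero_le_one fun x => ?_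
  change ‖boundedL a a (x : E)‖ ≤ 1 * ‖(x : E)‖
  refine closedSpan_induction (a := a) (P := fun x => ‖boundedL a a x‖ ≤ 1 * ‖x‖) ?_ (fun p => ?_)
    x.2
  · exact isClosed_le (by fun_prop) (by fun_prop)
  · have h := norm_triple_oddEval_le a 1 1 p
    have h1 : oddEval a 1 = a := by simp [oddEval_apply]
    rw [h1, ha, one_mul] at h
    exact h

theorem isDissipative_smul_restrictedL {a : E} {c : ℂ} (h : IsDissipative (c • boundedL a a)) :
    IsDissipative (c • restrictedL a) :=
  fun s hs x => h s hs (x : E)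

/-- Restriction to an invariant subspace may enlarge the spectrum, but it preserves dissipativity.
-/
theorem nonneg_of_mem_spectrum_restrictedL {a : E} {w : ℂ}
    (hw : w ∈ spectrum ℂ (restrictedL a)) : 0 ≤ w := by
  have hH : IsHermitianOp (boundedL a a) := isHermitianOp_L a
  have hneg : IsDissipative (-boundedL a a) := hH.isDissipative_neg (spectrum_L_nonneg a)
  have hI : ∀ t : ℝ, IsDissipative (((t : ℂ) * Complex.I) • boundedL a a) := hH.isDissipative_smul_I
  have h1 : IsDissipative (-restrictedL a) := fun s hs x => hneg s hs (x : E)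
  have h2 : IsDissipative (Complex.I • restrictedL a) := by
    have := isDissipative_smul_restrictedL (hI 1)
    rwa [Complex.ofReal_one, one_mul] at this
  have h3 : IsDissipative (-Complex.I • restrictedL a) := by
    have := isDissipative_smul_restrictedL (hI (-1))
    rwa [Complex.ofReal_neg, Complex.ofReal_one, neg_one_mul] at this
  exact nonneg_of_mem_spectrum_of_isDissipative h1 h2 h3 hw

theorem coe_aeval_restrictedL_apply (a : E) (q : ℂ[X]) (p : ℂ[X]) :
    (aeval (restrictedL a) q ⟨oddEval a p, oddEval_mem_closedSpan a p⟩ : E) =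
      oddEval a (q * p) := by
  induction q using Polynomial.induction_on' generalizing p with
  | add q q' hq hq' =>
    simp only [map_add, add_mul, ← hq, ← hq']
    rfl
  | monomial n c =>
    rw [← C_mul_X_pow_eq_monomial, mul_assoc, map_mul, aeval_C, ← smul_eq_C_mul, map_smul,
      Algebra.algebraMap_eq_smul_one, smul_mul_assoc, one_mul, smul_apply, Submodule.coe_smul]
    congr 1
    rw [map_pow, aeval_X]
    induction n generalizing p with
    | zero => simp
    | succ n ih =>
      rw [pow_succ, mul_apply_eq_comp, pow_succ, mul_assoc, ← ih]
      congr 2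
      exact Subtype.ext (triple_self_oddEval a p)

/-- Repeated cubing: k ↦ 3k + 1 turns exponent 2k + 1 into 3(2k + 1). -/
theorem exists_norm_oddEval_pow_mul_eq (a : E) {p : ℂ[X]} (hp : p.map (starRingEnd ℂ) = p)
    (j : ℕ) : ∃ k, j ≤ k ∧ ‖oddEval a ((X * p ^ 2) ^ k * p)‖ = ‖oddEval a p‖ ^ (2 * k + 1) := by
  induction j with
  | zero => exact ⟨0, le_rfl, by simp⟩
  | succ j ih =>
    obtain ⟨k, hjk, hk⟩ := ih
    refine ⟨3 * k + 1, by omega, ?_⟩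
    have h1 := norm_oddEval_pow_three a ((X * p ^ 2) ^ k * p)
    rw [hk, ← pow_mul] at h1
    convert h1 using 3
    · simp only [Polynomial.map_mul, Polynomial.map_pow, Polynomial.map_X, hp]
      ring
    · ring

/-- If x = ‖p(L(a,a))a‖ > 1, then x^(2k+1) ≤ C s^k x for arbitrarily large k and a fixed s strictly
between 1 and x², which is impossible. -/
theorem norm_oddEval_le_one {a : E} (ha : ‖a‖ = 1) {p : ℂ[X]} (hp : p.map (starRingEnd ℂ) = p)
    (h : ∀ u : ℝ, 0 ≤ u → u ≤ 1 → ‖(X * p ^ 2).eval (u : ℂ)‖ ≤ 1) : ‖oddEval a p‖ ≤ 1 := by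
  by_contra! hlt
  set x := ‖oddEval a p‖ with hx
  set q : ℂ[X] := X * p ^ 2 with hq
  have hx2 : 1 < x ^ 2 := one_lt_pow₀ hlt (by norm_num)
  obtain ⟨s, hs1, hsx⟩ := exists_between hx2
  obtain ⟨C, hC0, hC⟩ := exists_norm_aeval_pow_apply_le (norm_restrictedL_le_one ha)
    (fun w hw => nonneg_of_mem_spectrum_restrictedL hw) h hs1
  have hs0 : 0 < s := by linarith
  have hr : 1 < x ^ 2 / s := (one_lt_div hs0).2 hsx
  obtain ⟨n, hn⟩ := pow_unbounded_of_one_lt C hr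
  obtain ⟨k, hnk, hk⟩ := exists_norm_oddEval_pow_mul_eq a hp n
  have h3 : x ^ (2 * k + 1) ≤ C * s ^ k * x := by
    rw [← hk, ← coe_aeval_restrictedL_apply]
    exact hC k ⟨oddEval a p, oddEval_mem_closedSpan a p⟩
  rw [pow_succ, mul_le_mul_iff_left₀ (by linarith), pow_mul, ← div_le_iff₀ (by positivity),
    ← div_pow] at h3
  have h4 : (x ^ 2 / s) ^ n ≤ (x ^ 2 / s) ^ k := pow_le_pow_right₀ hr.le hnk
  linarith

/-- A norm-one functional attaining its norm at `a` takes the value one at `{a, a, a}`. -/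
theorem apply_triple_self_eq_one {a : E} (ha : ‖a‖ = 1) {φ : StrongDual ℂ E} (hφ : ‖φ‖ ≤ 1)
    (hφa : φ a = 1) : φ (triple a a a) = 1 := by
  have h0 : 0 ≤ φ (triple a a a) := form_self_nonneg hφ (by rw [hφa, ha]; simp) a
  have hle : ‖φ (triple a a a)‖ ≤ 1 :=
    (φ.le_of_opNorm_le hφ _).trans (by rw [norm_triple_self, ha]; norm_num)
  -- The odd function (3t - t³)/2 maps [0,1] to itself and fixes 1, and its cubic coefficient is
  -- negative: the bound on its norm becomes a lower bound for φ{a,a,a}.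
  have h1 : ‖oddEval a (C (3 / 2) - C (1 / 2) * X)‖ ≤ 1 := by
    refine norm_oddEval_le_one ha ?_ fun u hu0 hu1 => ?_
    · simp [map_ofNat]
    · have h2 : (X * (C (3 / 2) - C (1 / 2) * X) ^ 2 : ℂ[X]).eval (u : ℂ) =
          ((u * (3 / 2 - 1 / 2 * u) ^ 2 : ℝ) : ℂ) := by simp
      rw [h2, Complex.norm_real, Real.norm_of_nonneg (by positivity)]
      have h3 : 1 - u * (3 / 2 - 1 / 2 * u) ^ 2 = (1 - u) ^ 2 * (1 - u / 4) := by ring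
      have h4 : 0 ≤ (1 - u) ^ 2 * (1 - u / 4) := mul_nonneg (sq_nonneg _) (by linarith)
      linarith
  have h2 : oddEval a (C (3 / 2) - C (1 / 2) * X) =
      (3 / 2 : ℂ) • a - (1 / 2 : ℂ) • triple a a a := by
    rw [map_sub, ← smul_eq_C_mul, map_smul, oddEval_apply, oddEval_apply, aeval_C, aeval_X]
    rfl
  have h3 := (φ.le_of_opNorm_le hφ _).trans ((one_mul _).trans_le h1)
  rw [h2, map_sub, map_smul, map_smul, hφa] at h3
  have h4 := (Complex.re_le_norm _).trans h3
  have h5 := (Complex.re_le_norm _).trans hle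
  have h6 : ((3 / 2 : ℂ) • (1 : ℂ) - (1 / 2 : ℂ) • φ (triple a a a)).re =
      3 / 2 - 1 / 2 * (φ (triple a a a)).re := by simp
  rw [h6] at h4
  exact Complex.ext (by simp; linarith) (by simp [← (Complex.nonneg_iff.1 h0).2])

end JBStarTriple

theorem corollary4 {E : Type*} [NormedAddCommGroup E] [NormedSpace ℂ E] [CompleteSpace E]
    [JBStarTriple E] (a : E) (ha : ‖a‖ = 1) (φ : StrongDual ℂ E) (hφ : ‖φ‖ = 1)
    (hφa : φ a = 1) :
    (∀ x y : E, JBStarTriple.form φ a y x = starRingEnd ℂ (JBStarTriple.form φ a x y)) ∧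
    (∀ x : E, 0 ≤ JBStarTriple.form φ a x x) ∧
    JBStarTriple.form φ a a a = 1 := by
  have hφa' : φ a = ‖a‖ := by rw [hφa, ha]; simp
  exact ⟨JBStarTriple.form_conj_symm hφ.le hφa', JBStarTriple.form_self_nonneg hφ.le hφa',
    JBStarTriple.apply_triple_self_eq_one ha hφ.le hφa⟩
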